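/- Consider, for each $n$, a network of $n$ transmitter–receiver links. Let $g_{ji}$ $(1\le i,j\le n)$, the power gain from transmitter $j$ to receiver $i$, be i.i.d. exponential random variables with mean $1$, and let $\rho>0$ be a fixed signal-to-noise ratio. For a set $\mathcal A$ of active links, the rate of link $i\in\mathcal A$ is $$r_i(\mathcal A)=\log\Bigl(1+\frac{g_{ii}}{1/\rho+\sum_{j\in\mathcal A,\,j\ne i}g_{ji}}\Bigr).$$ The double-threshold-based link activation strategy (DTBLAS) with thresholds $\Delta$ and $\delta$ first forms $\mathcal A_1=\{i: g_{ii}>\Delta\}$ and then activates a largest set $\mathcal A\subseteq\mathcal A_1$ such that $g_{ij}\le\delta$ and $g_{ji}\le\delta$ for all distinct $i,j\in\mathcal A$; that is, a maximum clique, contained in $\mathcal A_1$, of the graph in which distinct $i,j$ are adjacent iff $g_{ij}\le\delta$ and $g_{ji}\le\delta$. If there are several such sets, the choice is made by an arbitrary fixed rule that depends only on $\mathcal A_1$ and this graph. Let $0<\alpha'\le 1$ and $\delta>0$ be constants, let $\Delta=(1-\alpha')\log n$, and put $$\hat\mu=\mathrm E\{g\mid g\le\delta\}\ \text{ for } g\sim\mathrm{Exp}(1),\qquad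 \bar r=\log\Bigl(1-\frac{(1-\alpha')\log(1-e^{-\delta})}{\alpha'\hat\mu}\Bigr).$$ Then there is a constant $c>0$, depending only on $\alpha'$ and $\delta$, such that for every $\rho>0$, with probability tending to $1$ as $n\to\infty$, $$|r_i(\mathcal A)-\bar r|<c\sqrt{\frac{\log\log n}{\log n}}\,(1+o(1))\qquad\text{for all } i\in\mathcal A,$$ where the $o(1)$ is a deterministic sequence. Consequently, for every $\lambda<\bar r$, with probability tending to $1$ all active links satisfy the rate constraint $r_i(\mathcal A)\ge\lambda$. -/

import Mathlib

open MeasureTheory ProbabilityTheory Filter Topology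

namespace DTBLAS

/-- I.i.d. Rayleigh fading in a network of `n` links: the power gains `g j i` from transmitter `j`
to receiver `i` are mutually independent, each exponentially distributed with mean `1`. -/
structure IsRayleighFading {n : ℕ} {Ω : Type*} [MeasurableSpace Ω]
    (g : Fin n → Fin n → Ω → ℝ) (P : Measure Ω) : Prop where
  law : ∀ j i, HasLaw (g j i) (expMeasure 1) P
  indep : iIndepFun (fun q : Fin n × Fin n => g q.1 q.2) P

/-- The links surviving the first phase: those with direct gain above `Δ`. -/
noncomputable def phaseOne {n : ℕ} (Δ : ℝ) (G : Fin n → Fin n → ℝ) : Finset (Fin n) :=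
  Finset.univ.filter fun i => Δ < G i i

/-- The compatibility graph: two distinct links are adjacent when both cross gains between them
are at most `δ`. -/
def compatGraph {n : ℕ} (δ : ℝ) (G : Fin n → Fin n → ℝ) : SimpleGraph (Fin n) where
  Adj i j := i ≠ j ∧ G i j ≤ δ ∧ G j i ≤ δ
  symm := ⟨fun _ _ h => ⟨h.1.symm, h.2.2, h.2.1⟩⟩
  loopless := ⟨fun _ h => h.1 rfl⟩

/-- `A` is a clique of `H` inside `V`, of the largest possible size. -/
def IsLargestClique {n : ℕ} (V : Finset (Fin n)) (H : SimpleGraph (Fin n))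
    (A : Finset (Fin n)) : Prop :=
  (A ⊆ V ∧ H.IsClique (A : Set (Fin n))) ∧
    ∀ B : Finset (Fin n), B ⊆ V → H.IsClique (B : Set (Fin n)) → B.card ≤ A.card

/-- A rule for the second phase: it sees the set `V` of surviving links and the compatibility graph
`H`, and returns a largest clique of `H` inside `V`. How ties are broken is arbitrary. -/
structure SelectionRule (n : ℕ) where
  pick : Finset (Fin n) → SimpleGraph (Fin n) → Finset (Fin n)
  isLargest : ∀ V H, IsLargestClique V H (pick V H)

/-- The set of active links chosen by the double-threshold strategy. -/
noncomputable def active {n : ℕ} (S : SelectionRule n) (Δ δ : ℝ) (G : Fin n → Fin n → ℝ) :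
    Finset (Fin n) :=
  S.pick (phaseOne Δ G) (compatGraph δ G)

/-- Signal-to-interference-plus-noise ratio of link `i` when the links in `A` are active. -/
noncomputable def sinr {n : ℕ} (ρ : ℝ) (G : Fin n → Fin n → ℝ) (A : Finset (Fin n))
    (i : Fin n) : ℝ :=
  G i i / (1 / ρ + ∑ j ∈ A.erase i, G j i)

/-- Rate of link `i`, in nats per channel use. -/
noncomputable def rate {n : ℕ} (ρ : ℝ) (G : Fin n → Fin n → ℝ) (A : Finset (Fin n))
    (i : Fin n) : ℝ :=
  Real.log (1 + sinr ρ G A i)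

/-- The mean of an exponential gain conditioned on being at most `δ`. -/
noncomputable def truncMean (δ : ℝ) : ℝ :=
  ∫ x, x ∂(cond (expMeasure 1) (Set.Iic δ))

/-- The limiting rate per active link. -/
noncomputable def rBar (α' δ : ℝ) : ℝ :=
  Real.log (1 - (1 - α') * Real.log (1 - Real.exp (-δ)) / (α' * truncMean δ))

/-- The events `E n` hold asymptotically almost surely. -/
def AAS {Ω : ℕ → Type*} [∀ n, MeasurableSpace (Ω n)] (P : ∀ n, Measure (Ω n))
    (E : ∀ n, Set (Ω n)) : Prop :=
  Tendsto (fun n => P n (E n)) atTop (𝓝 1)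

end DTBLAS

namespace DTBLAS

/-! Write `l = log n`, `a = 1 - exp (-δ)` and `b = -log a`. The number of active links and the gains
seen by them are controlled separately.

A given set of `k` links is a clique of surviving links with probability `(exp (-Δ) * a ^ (k - 1)) ^
k`, so such cliques cease to exist near `k = α' * l / b`. A first moment bound
(`gainMeasure_exists_clique_le`) and a second moment bound (`gainMeasure_forall_not_clique_le`)
place the number of active links within `O(log l)` of this value.

The active set depends on the gains, but only through the side of its threshold on which each gain
lies. Conditioned on all sides (`pi_le_of_forall_cond_le`), the active set is fixed and the gains
remain independent: a direct gain of an active link is `Δ` plus a fresh exponential, and cross gains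
between active links are exponentials truncated at `δ`. A union bound over the `O(l)` active links
therefore suffices, with no cost for the choice of the set (`gainMeasure_atypical_le`): an excess of
`2 * log l` in a direct gain has probability `l⁻²`, and by Hoeffding so, up to a factor 2, has a
deviation of order `√(l * log l)` in the interference.

Outside an event of probability `O(1 / l)`, signal and interference are thus `(1 - α') * l` and `α'
/ b * truncMean δ * l` up to `O(√(l * log l))`, and the constant noise is absorbed. Their ratio has
error `O(√(log l / l))`, which `log (1 + ·)` does not enlarge. -/

/-! ### The exponential law and its truncation -/

instance isProbabilityMeasure_expMeasure_one : IsProbabilityMeasure (expMeasure 1) :=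
  isProbabilityMeasure_expMeasure one_pos

lemma expMeasure_real_Iic {x : ℝ} (hx : 0 ≤ x) :
    (expMeasure 1).real (Set.Iic x) = 1 - Real.exp (-x) := by
  rw [← cdf_eq_real, cdf_expMeasure_eq one_pos, if_pos hx, one_mul]

lemma expMeasure_real_Ioi {x : ℝ} (hx : 0 ≤ x) :
    (expMeasure 1).real (Set.Ioi x) = Real.exp (-x) := by
  rw [← Set.compl_Iic, probReal_compl_eq_one_sub measurableSet_Iic, expMeasure_real_Iic hx]
  ring

lemma expMeasure_Ioi {x : ℝ} (hx : 0 ≤ x) :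
    expMeasure 1 (Set.Ioi x) = ENNReal.ofReal (Real.exp (-x)) := by
  rw [← expMeasure_real_Ioi hx, ofReal_measureReal]

lemma expMeasure_ae_pos : ∀ᵐ x ∂(expMeasure 1), 0 < x := by
  have h : (expMeasure 1).real (Set.Iic 0) = 0 := by
    rw [expMeasure_real_Iic le_rfl]; simp
  rw [measureReal_eq_zero_iff] at h
  rw [ae_iff]
  convert h using 2
  ext x; simp

lemma expMeasure_Iic_ne_zero {δ : ℝ} (hδ : 0 < δ) : expMeasure 1 (Set.Iic δ) ≠ 0 := by
  intro h
  have := expMeasure_real_Iic hδ.le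
  rw [measureReal_def, h, ENNReal.toReal_zero] at this
  have h2 : Real.exp (-δ) < 1 := by simpa using hδ
  linarith

lemma cond_ae_mem_Ioc (δ : ℝ) :
    ∀ᵐ x ∂(cond (expMeasure 1) (Set.Iic δ)), x ∈ Set.Ioc 0 δ := by
  have h1 : ∀ᵐ x ∂(cond (expMeasure 1) (Set.Iic δ)), 0 < x :=
    cond_absolutelyContinuous.ae_le expMeasure_ae_pos
  filter_upwards [h1, ae_cond_mem measurableSet_Iic] with x hx hx' using ⟨hx, hx'⟩

lemma truncMean_pos {δ : ℝ} (hδ : 0 < δ) : 0 < truncMean δ := by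
  have := cond_isProbabilityMeasure (expMeasure_Iic_ne_zero hδ)
  have hm := cond_ae_mem_Ioc δ
  have hint : Integrable (fun x : ℝ => x) (cond (expMeasure 1) (Set.Iic δ)) :=
    Integrable.of_mem_Icc 0 δ aemeasurable_id (hm.mono fun x hx => ⟨hx.1.le, hx.2⟩)
  rw [truncMean, integral_pos_iff_support_of_nonneg_ae (hm.mono fun x hx => hx.1.le) hint]
  have : cond (expMeasure 1) (Set.Iic δ) (Function.support fun x : ℝ => x) = 1 := by
    rw [← prob_compl_eq_zero_iff (by measurability)]
    refine measure_mono_null ?_ (ae_iff.1 hm)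
    intro x hx
    simp at hx
    simp [hx]
  rw [this]; exact one_pos

/-! ### Reduction to the product measure -/

/-- The joint law of the gains of a network of `n` links. -/
noncomputable abbrev gainMeasure (n : ℕ) : Measure (Fin n × Fin n → ℝ) :=
  Measure.pi fun _ => expMeasure 1

lemma IsRayleighFading.map_eq {n : ℕ} {Ω : Type*} [MeasurableSpace Ω] {P : Measure Ω}
    [IsProbabilityMeasure P] {g : Fin n → Fin n → Ω → ℝ} (hg : IsRayleighFading g P) :
    P.map (fun ω q => g q.1 q.2 ω) = gainMeasure n := by
  refine ((iIndepFun_iff_map_fun_eq_pi_map fun q : Fin n × Fin n => (hg.law q.1 q.2).aemeasurable).1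
    hg.indep).trans ?_
  congr
  ext1 q
  exact (hg.law q.1 q.2).map_eq

/-- Only this inequality is needed, and it holds for arbitrary sets, so no measurability of events
about the selection rule has to be proved. -/
lemma IsRayleighFading.measure_le {n : ℕ} {Ω : Type*} [MeasurableSpace Ω] {P : Measure Ω}
    [IsProbabilityMeasure P] {g : Fin n → Fin n → Ω → ℝ} (hg : IsRayleighFading g P)
    (p : (Fin n → Fin n → ℝ) → Prop) :
    P {ω | p fun j i => g j i ω} ≤ gainMeasure n {x | p fun j i => x (j, i)} := by
  rw [← hg.map_eq]
  exact Measure.le_map_apply (f := fun ω (q : Fin n × Fin n) => g q.1 q.2 ω)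
    (aemeasurable_pi_lambda _ fun q => (hg.law q.1 q.2).aemeasurable)
    {x | p fun j i => x (j, i)}

/-! ### Conditioning on the threshold pattern -/

/-- The values on the side of the threshold `τ` prescribed by membership in `T`. -/
def side {ι : Type*} (τ : ι → ℝ) (T : Set ι) (q : ι) : Set ℝ :=
  {u | u ≤ τ q ↔ q ∈ T}

lemma side_of_mem {ι : Type*} {τ : ι → ℝ} {T : Set ι} {q : ι} (h : q ∈ T) :
    side τ T q = Set.Iic (τ q) := by
  ext u; simp [side, h]

lemma side_of_notMem {ι : Type*} {τ : ι → ℝ} {T : Set ι} {q : ι} (h : q ∉ T) :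
    side τ T q = Set.Ioi (τ q) := by
  ext u; simp [side, h]

lemma measurableSet_side {ι : Type*} (τ : ι → ℝ) (T : Set ι) (q : ι) :
    MeasurableSet (side τ T q) := by
  by_cases h : q ∈ T
  · rw [side_of_mem h]; exact measurableSet_Iic
  · rw [side_of_notMem h]; exact measurableSet_Ioi

/-- Law of total probability over the boxes cut out by the thresholds. Conditioning a product
measure on a box conditions each factor, so independence survives. Subadditivity replaces additivity
on `D`, which need not be measurable. -/
lemma pi_le_of_forall_cond_le {ι : Type*} [Fintype ι] (μ : ι → Measure ℝ)
    [∀ q, IsProbabilityMeasure (μ q)] (τ : ι → ℝ) (D : Set (ι → ℝ)) (η : ENNReal)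
    (h : ∀ T : Set ι, (∀ q, μ q (side τ T q) ≠ 0) →
      Measure.pi (fun q => cond (μ q) (side τ T q)) D ≤ η) :
    Measure.pi μ D ≤ η := by
  classical
  set box : Set ι → Set (ι → ℝ) := fun T => Set.univ.pi (side τ T) with hbox
  have hmeas : ∀ T, MeasurableSet (box T) := fun T =>
    MeasurableSet.univ_pi (measurableSet_side τ T)
  have hdisj : Pairwise (Function.onFun Disjoint box) := by
    intro T T' hne
    refine Set.disjoint_left.2 fun x hx hx' => hne ?_
    ext q
    exact (hx q trivial).symm.trans (hx' q trivial)
  have hcover : (⋃ T, box T) = Set.univ := by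
    refine Set.eq_univ_of_forall fun x => Set.mem_iUnion.2 ⟨{q | x q ≤ τ q}, ?_⟩
    intro q _
    exact Iff.rfl
  have hpiece : ∀ T, Measure.pi μ (D ∩ box T) ≤ η * Measure.pi μ (box T) := by
    intro T
    by_cases h0 : ∃ q, μ q (side τ T q) = 0
    · obtain ⟨q, hq⟩ := h0
      have : Measure.pi μ (box T) = 0 := by
        rw [hbox, Measure.pi_pi]
        exact Finset.prod_eq_zero (Finset.mem_univ q) hq
      rw [measure_mono_null Set.inter_subset_right this]
      exact zero_le
    · push Not at h0
      have hc : Measure.pi (fun q => cond (μ q) (side τ T q)) = cond (Measure.pi μ) (box T) := by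
        have := fun q => cond_isProbabilityMeasure (h0 q)
        refine Measure.pi_eq fun s hs => ?_
        rw [cond_apply (hmeas T), hbox, ← Set.pi_inter_distrib, Measure.pi_pi, Measure.pi_pi,
          ENNReal.prod_inv_distrib, ← Finset.prod_mul_distrib]
        · exact Finset.prod_congr rfl fun q _ => (cond_apply (measurableSet_side τ T q) _ _).symm
        -- Inverting the product in `ENNReal` must exclude `0 * ∞`; here no factor vanishes.
        · intro i _ j _ _
          exact Or.inl (h0 i)
      have h1 := h T h0
      rw [hc] at h1
      rw [Set.inter_comm, ← cond_mul_eq_inter (hmeas T)]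
      gcongr
  calc Measure.pi μ D ≤ ∑' T, Measure.pi μ (D ∩ box T) := by
        conv_lhs => rw [← Set.inter_univ D, ← hcover, Set.inter_iUnion]
        exact measure_iUnion_le _
    _ ≤ ∑' T, η * Measure.pi μ (box T) := ENNReal.tsum_le_tsum hpiece
    _ = η * Measure.pi μ (⋃ T, box T) := by
        rw [ENNReal.tsum_mul_left, measure_iUnion hdisj hmeas]
    _ = η := by rw [hcover, measure_univ, mul_one]

/-- The threshold to which the gain on the pair `q` is compared. -/
def threshold {n : ℕ} (Δ δ : ℝ) (q : Fin n × Fin n) : ℝ :=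
  if q.1 = q.2 then Δ else δ

lemma active_congr {n : ℕ} (S : SelectionRule n) {Δ δ : ℝ} {G H : Fin n → Fin n → ℝ}
    (h : ∀ q : Fin n × Fin n, G q.1 q.2 ≤ threshold Δ δ q ↔ H q.1 q.2 ≤ threshold Δ δ q) :
    active S Δ δ G = active S Δ δ H := by
  have h1 : phaseOne Δ G = phaseOne Δ H := by
    refine Finset.filter_congr fun i _ => ?_
    have := h (i, i)
    simp only [threshold, if_true] at this
    rw [← not_le, ← not_le, this]
  have h2 : compatGraph δ G = compatGraph δ H := by
    ext i j
    simp only [compatGraph]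
    refine and_congr_right fun hij => ?_
    have h1 := h (i, j)
    have h2 := h (j, i)
    simp only [threshold, if_neg hij, if_neg hij.symm] at h1 h2
    rw [h1, h2]
  rw [active, active, h1, h2]

lemma lt_of_mem_active {n : ℕ} {S : SelectionRule n} {Δ δ : ℝ} {G : Fin n → Fin n → ℝ} {i : Fin n}
    (hi : i ∈ active S Δ δ G) : Δ < G i i := by
  have := (S.isLargest (phaseOne Δ G) (compatGraph δ G)).1.1 hi
  simpa [phaseOne] using this

lemma le_of_mem_active {n : ℕ} {S : SelectionRule n} {Δ δ : ℝ} {G : Fin n → Fin n → ℝ} {i j : Fin n}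
    (hi : i ∈ active S Δ δ G) (hj : j ∈ active S Δ δ G) (hij : j ≠ i) : G j i ≤ δ :=
  ((S.isLargest (phaseOne Δ G) (compatGraph δ G)).1.2 hj hi hij).2.1

/-- Memorylessness of the exponential law. -/
lemma cond_Ioi_Ioi {Δ s : ℝ} (hΔ : 0 ≤ Δ) (hs : 0 ≤ s) :
    cond (expMeasure 1) (Set.Ioi Δ) (Set.Ioi (Δ + s)) = ENNReal.ofReal (Real.exp (-s)) := by
  rw [cond_apply measurableSet_Ioi, Set.inter_eq_right.2 (Set.Ioi_subset_Ioi (by linarith)),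
    expMeasure_Ioi hΔ, expMeasure_Ioi (by positivity), ← ENNReal.ofReal_inv_of_pos (Real.exp_pos _),
    ← ENNReal.ofReal_mul (by positivity), ← Real.exp_neg, ← Real.exp_add]
  congr 2; ring

/-- Hoeffding's lemma for a variable with values in `[0, δ]`. -/
lemma hasSubgaussianMGF_cond {δ : ℝ} (hδ : 0 < δ) :
    HasSubgaussianMGF (fun u => u - truncMean δ) ((‖δ‖₊ / 2) ^ 2)
      (cond (expMeasure 1) (Set.Iic δ)) := by
  have := cond_isProbabilityMeasure (expMeasure_Iic_ne_zero hδ)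
  have h := hasSubgaussianMGF_of_mem_Icc (X := fun u : ℝ => u) (a := 0) (b := δ)
    (μ := cond (expMeasure 1) (Set.Iic δ)) aemeasurable_id
    ((cond_ae_mem_Ioc δ).mono fun x hx => ⟨hx.1.le, hx.2⟩)
  simpa [truncMean] using h

/-- **Hoeffding's inequality** for a sum of independent gains, those in the sum being conditioned to
be at most `δ`. -/
lemma pi_abs_sum_ge_le {ι : Type*} [Fintype ι] (ν : ι → Measure ℝ) [∀ q, IsProbabilityMeasure (ν q)]
    {δ : ℝ} (hδ : 0 < δ) (s : Finset ι) (hs : ∀ q ∈ s, ν q = cond (expMeasure 1) (Set.Iic δ))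
    {t M : ℝ} (ht : 0 < t) (hM : (s.card : ℝ) ≤ M) :
    Measure.pi ν {x | t ≤ |∑ q ∈ s, (x q - truncMean δ)|}
      ≤ ENNReal.ofReal (2 * Real.exp (-(2 * t ^ 2 / (M * δ ^ 2)))) := by
  rcases s.eq_empty_or_nonempty with rfl | hne
  · simp [not_le.2 ht]
  have hcard : (0 : ℝ) < s.card := by exact_mod_cast hne.card_pos
  have hsub : ∀ q ∈ s, HasSubgaussianMGF (fun x : ι → ℝ => x q - truncMean δ) ((‖δ‖₊ / 2) ^ 2)
      (Measure.pi ν) := by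
    intro q hq
    have h1 := hasSubgaussianMGF_cond hδ
    rw [← hs q hq, ← (measurePreserving_eval ν q).map_eq] at h1
    exact HasSubgaussianMGF.of_map (μ := Measure.pi ν) (Y := Function.eval q)
      (X := fun u => u - truncMean δ) (measurable_pi_apply q).aemeasurable h1
  have hind : iIndepFun (fun (q : ι) (x : ι → ℝ) => x q - truncMean δ) (Measure.pi ν) :=
    iIndepFun_pi (X := fun _ u => u - truncMean δ) fun _ => by fun_prop
  have hsum := HasSubgaussianMGF.sum_of_iIndepFun hind hsub
  have hexp : Real.exp (-t ^ 2 / (2 * (∑ _q ∈ s, (‖δ‖₊ / 2) ^ 2 : NNReal)))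
      ≤ Real.exp (-(2 * t ^ 2 / (M * δ ^ 2))) := by
    refine Real.exp_le_exp.2 ?_
    have : -t ^ 2 / (2 * ((∑ _q ∈ s, (‖δ‖₊ / 2) ^ 2 : NNReal) : ℝ))
        = -(2 * t ^ 2 / (s.card * δ ^ 2)) := by
      simp only [Finset.sum_const, nsmul_eq_mul, NNReal.coe_mul, NNReal.coe_natCast, NNReal.coe_pow,
        NNReal.coe_div, coe_nnnorm, Real.norm_eq_abs, NNReal.coe_ofNat, div_pow, sq_abs]
      field_simp
    rw [this, neg_le_neg_iff]
    gcongr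
  have h1 := (hsum.measure_ge_le ht.le).trans hexp
  have h2 := (hsum.neg.measure_ge_le ht.le).trans hexp
  rw [← ofReal_measureReal]
  refine ENNReal.ofReal_le_ofReal ?_
  calc (Measure.pi ν).real {x | t ≤ |∑ q ∈ s, (x q - truncMean δ)|}
      ≤ (Measure.pi ν).real ({x | t ≤ ∑ q ∈ s, (x q - truncMean δ)} ∪
          {x | t ≤ (-fun x : ι → ℝ => ∑ q ∈ s, (x q - truncMean δ)) x}) :=
        measureReal_mono fun x (hx : t ≤ |_|) => le_abs.1 hx
    _ ≤ _ := (measureReal_union_le _ _).trans (by rw [two_mul]; exact add_le_add h1 h2)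

/-- Given that few links are active, it is unlikely that an active link has a large excess direct
gain or an interference far from its mean. -/
lemma gainMeasure_atypical_le {n : ℕ} (S : SelectionRule n) {Δ δ s t M : ℝ} (hΔ : 0 ≤ Δ)
    (hδ : 0 < δ) (hs : 0 ≤ s) (ht : 0 < t) :
    gainMeasure n {x | ((active S Δ δ fun j i => x (j, i)).card : ℝ) ≤ M ∧
        ∃ i ∈ active S Δ δ fun j i => x (j, i), Δ + s < x (i, i) ∨
          t ≤ |∑ j ∈ (active S Δ δ fun j i => x (j, i)).erase i, (x (j, i) - truncMean δ)|}
      ≤ ENNReal.ofReal (M * (Real.exp (-s) + 2 * Real.exp (-(2 * t ^ 2 / (M * δ ^ 2))))) := by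
  refine pi_le_of_forall_cond_le _ (threshold Δ δ) _ _ fun T hT => ?_
  have hprob := fun q => cond_isProbabilityMeasure (hT q)
  have hbox : ∀ᵐ x ∂Measure.pi fun q => cond (expMeasure 1) (side (threshold Δ δ) T q),
      ∀ q, x q ∈ side (threshold Δ δ) T q :=
    ae_all_iff.2 fun q => Measure.tendsto_eval_ae_ae.eventually
      (ae_cond_mem (measurableSet_side _ T q))
  -- Any point `y` of the box serves as representative: the active set is the same at all of its
  -- points.
  obtain ⟨y, hy⟩ := hbox.exists
  obtain ⟨A, hA⟩ : ∃ A, A = active S Δ δ fun j i => y (j, i) := ⟨_, rfl⟩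
  have hact : ∀ x : Fin n × Fin n → ℝ, (∀ q, x q ∈ side (threshold Δ δ) T q) →
      (active S Δ δ fun j i => x (j, i)) = A := fun x hx => by
    rw [hA]
    exact active_congr S fun q => (hx q).trans (hy q).symm
  have hdiag : ∀ i ∈ A, side (threshold Δ δ) T (i, i) = Set.Ioi Δ := by
    intro i hi
    rw [hA] at hi
    have h1 := lt_of_mem_active hi
    have h2 : (i, i) ∉ T := fun h => by
      have := (hy (i, i)).2 h
      simp only [threshold, if_true] at this
      exact absurd h1 (not_lt.2 this)
    rw [side_of_notMem h2]; simp [threshold]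
  have hoff : ∀ i ∈ A, ∀ j ∈ A.erase i, side (threshold Δ δ) T (j, i) = Set.Iic δ := by
    intro i hi j hj
    have hji : j ≠ i := Finset.ne_of_mem_erase hj
    have hjA := Finset.mem_of_mem_erase hj
    rw [hA] at hi hjA
    have h1 := le_of_mem_active hi hjA hji
    have h2 : (j, i) ∈ T := (hy (j, i)).1 (by simpa [threshold, hji] using h1)
    rw [side_of_mem h2]; simp [threshold, hji]
  by_cases hcard : (A.card : ℝ) ≤ M
  swap
  -- If the fixed active set is too large, the event is null under this conditioning.
  · refine le_of_eq_of_le (measure_mono_null ?_ (ae_iff.1 hbox)) zero_le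
    intro x hx hbx
    rw [Set.mem_ofPred_eq, hact x hbx] at hx
    exact hcard hx.1
  calc _ ≤ Measure.pi (fun q => cond (expMeasure 1) (side (threshold Δ δ) T q))
        (⋃ i ∈ A, ({x | x (i, i) ∈ Set.Ioi (Δ + s)} ∪
          {x | t ≤ |∑ j ∈ A.erase i, (x (j, i) - truncMean δ)|})) := by
        refine measure_mono_ae ?_
        filter_upwards [hbox] with x hx hxm
        obtain ⟨-, i, hi, hi'⟩ := hxm
        rw [hact x hx] at hi hi'
        exact Set.mem_biUnion hi hi'
    _ ≤ ∑ i ∈ A, ENNReal.ofReal (Real.exp (-s) + 2 * Real.exp (-(2 * t ^ 2 / (M * δ ^ 2)))) := by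
        refine (measure_biUnion_finset_le _ _).trans (Finset.sum_le_sum fun i hi => ?_)
        refine (measure_union_le _ _).trans ?_
        rw [ENNReal.ofReal_add (by positivity) (by positivity)]
        refine add_le_add ?_ ?_
        · rw [← cond_Ioi_Ioi hΔ hs, ← hdiag i hi]
          exact ((measurePreserving_eval _ (i, i)).measure_preimage
            measurableSet_Ioi.nullMeasurableSet).le
        · have := pi_abs_sum_ge_le (fun q => cond (expMeasure 1) (side (threshold Δ δ) T q)) hδ
            ((A.erase i).map (.sectL (Fin n) i))
            (by
              intro q hq
              obtain ⟨j, hj, rfl⟩ := Finset.mem_map.1 hq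
              simp only [Function.Embedding.sectL_apply, hoff i hi j hj]) ht
            (M := M) (by
              rw [Finset.card_map]
              exact le_trans (by exact_mod_cast Finset.card_erase_le) hcard)
          simpa only [Finset.sum_map, Function.Embedding.sectL_apply] using this
    _ ≤ _ := by
        rw [Finset.sum_const, nsmul_eq_mul, ← ENNReal.ofReal_natCast,
          ← ENNReal.ofReal_mul (by positivity)]
        gcongr

/-! ### First and second moments of the number of cliques -/

/-- The event that `S` is a clique of the compatibility graph, contained in the set of links
surviving the first phase. -/
def cliqueEvent {n : ℕ} (Δ δ : ℝ) (S : Finset (Fin n)) : Set (Fin n × Fin n → ℝ) :=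
  Set.pi ↑(S ×ˢ S) fun q => if q.1 = q.2 then Set.Ioi Δ else Set.Iic δ

lemma mem_cliqueEvent_iff {n : ℕ} {Δ δ : ℝ} {S : Finset (Fin n)} {x : Fin n × Fin n → ℝ} :
    x ∈ cliqueEvent Δ δ S ↔ S ⊆ phaseOne Δ (fun j i => x (j, i)) ∧
      (compatGraph δ fun j i => x (j, i)).IsClique (S : Set (Fin n)) := by
  constructor
  · intro h
    refine ⟨fun i hi => ?_, fun i hi j hj hij => ⟨hij, ?_, ?_⟩⟩
    · have := h (i, i) (by simpa using hi)
      simpa [phaseOne] using this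
    · have := h (i, j) (by simpa using ⟨hi, hj⟩)
      simpa [hij] using this
    · have := h (j, i) (by simpa using ⟨hj, hi⟩)
      simpa [hij.symm] using this
  · rintro ⟨h1, h2⟩ ⟨i, j⟩ hij
    obtain ⟨hi, hj⟩ : i ∈ S ∧ j ∈ S := by simpa using hij
    by_cases hne : i = j
    · subst hne
      have := h1 hi
      simpa [phaseOne] using this
    · simpa [hne] using (h2 hi hj hne).2.1

lemma measurableSet_cliqueEvent {n : ℕ} (Δ δ : ℝ) (S : Finset (Fin n)) :
    MeasurableSet (cliqueEvent Δ δ S) := by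
  refine MeasurableSet.pi (Finset.countable_toSet _) fun q _ => ?_
  split_ifs
  · exact measurableSet_Ioi
  · exact measurableSet_Iic

/-- The probability that the gain on the pair `q` allows `q` inside an active set. -/
noncomputable def pairProb {n : ℕ} (Δ δ : ℝ) (q : Fin n × Fin n) : ℝ :=
  if q.1 = q.2 then Real.exp (-Δ) else 1 - Real.exp (-δ)

/-- The probability that a given set of `k` links is a clique of surviving links. -/
noncomputable def cliqueProb (Δ δ : ℝ) (k : ℕ) : ℝ :=
  (Real.exp (-Δ) * (1 - Real.exp (-δ)) ^ (k - 1)) ^ k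

lemma one_sub_exp_neg_pos {δ : ℝ} (hδ : 0 < δ) : 0 < 1 - Real.exp (-δ) := by
  have : Real.exp (-δ) < 1 := by simpa using hδ
  linarith

lemma one_sub_exp_neg_lt_one (δ : ℝ) : 1 - Real.exp (-δ) < 1 := by
  linarith [Real.exp_pos (-δ)]

lemma cliqueProb_pos {Δ δ : ℝ} (hδ : 0 < δ) (k : ℕ) : 0 < cliqueProb Δ δ k := by
  have := one_sub_exp_neg_pos hδ
  unfold cliqueProb
  positivity

lemma gainMeasure_real_pi {n : ℕ} {Δ δ : ℝ} (hΔ : 0 ≤ Δ) (hδ : 0 ≤ δ)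
    (Q : Finset (Fin n × Fin n)) :
    (gainMeasure n).real (Set.pi ↑Q fun q => if q.1 = q.2 then Set.Ioi Δ else Set.Iic δ)
      = ∏ q ∈ Q, pairProb Δ δ q := by
  rw [measureReal_def, Measure.pi_pi_finset, ENNReal.toReal_prod]
  refine Finset.prod_congr rfl fun q _ => ?_
  unfold pairProb
  split_ifs
  · exact expMeasure_real_Ioi hΔ
  · exact expMeasure_real_Iic hδ

lemma prod_pairProb {n : ℕ} (Δ δ : ℝ) (S : Finset (Fin n)) :
    ∏ q ∈ S ×ˢ S, pairProb Δ δ q = cliqueProb Δ δ S.card := by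
  rw [← Finset.diag_union_offDiag, Finset.prod_union (Finset.disjoint_diag_offDiag S),
    Finset.prod_congr rfl (g := fun _ => Real.exp (-Δ)),
    Finset.prod_congr (s₁ := S.offDiag) rfl (g := fun _ => 1 - Real.exp (-δ)),
    Finset.prod_const, Finset.prod_const, Finset.diag_card, Finset.offDiag_card, cliqueProb,
    mul_pow, ← pow_mul, Nat.sub_mul, one_mul]
  · intro q hq
    simp [pairProb, (Finset.mem_offDiag.1 hq).2.2]
  · intro q hq
    simp [pairProb, (Finset.mem_diag.1 hq).2]

lemma gainMeasure_cliqueEvent {n : ℕ} {Δ δ : ℝ} (hΔ : 0 ≤ Δ) (hδ : 0 ≤ δ) (S : Finset (Fin n)) :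
    (gainMeasure n).real (cliqueEvent Δ δ S) = cliqueProb Δ δ S.card := by
  rw [cliqueEvent, gainMeasure_real_pi hΔ hδ, prod_pairProb]

/-- The two events share exactly the constraints on pairs in `(S ∩ T) ×ˢ (S ∩ T)`, which the product
of the two probabilities counts twice. -/
lemma gainMeasure_cliqueEvent_inter {n : ℕ} {Δ δ : ℝ} (hΔ : 0 ≤ Δ) (hδ : 0 < δ)
    (S T : Finset (Fin n)) :
    (gainMeasure n).real (cliqueEvent Δ δ S ∩ cliqueEvent Δ δ T)
      = cliqueProb Δ δ S.card * cliqueProb Δ δ T.card * (cliqueProb Δ δ (S ∩ T).card)⁻¹ := by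
  rw [cliqueEvent, cliqueEvent, ← Set.union_pi, ← Finset.coe_union, gainMeasure_real_pi hΔ hδ.le,
    eq_mul_inv_iff_mul_eq₀ (cliqueProb_pos hδ _).ne', ← prod_pairProb, ← prod_pairProb,
    ← prod_pairProb, ← Finset.product_inter_product, Finset.prod_union_inter]

/-- The first moment bound: large cliques of surviving links are unlikely. -/
lemma gainMeasure_exists_clique_le {n : ℕ} {Δ δ : ℝ} (hΔ : 0 ≤ Δ) (hδ : 0 < δ) (k : ℕ) :
    (gainMeasure n).real {x | ∃ S : Finset (Fin n), S.card = k ∧ x ∈ cliqueEvent Δ δ S}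
      ≤ (n * (Real.exp (-Δ) * (1 - Real.exp (-δ)) ^ (k - 1))) ^ k := by
  calc _ ≤ (gainMeasure n).real
        (⋃ S ∈ Finset.powersetCard k Finset.univ, cliqueEvent Δ δ S) := by
        refine measureReal_mono ?_ (measure_ne_top _ _)
        rintro x ⟨S, hS, hx⟩
        exact Set.mem_biUnion (Finset.mem_powersetCard.2 ⟨Finset.subset_univ S, hS⟩) hx
    _ ≤ ∑ S ∈ Finset.powersetCard k Finset.univ, (gainMeasure n).real (cliqueEvent Δ δ S) :=
        measureReal_biUnion_finset_le _ _
    _ = n.choose k * cliqueProb Δ δ k := by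
        rw [Finset.sum_congr rfl (g := fun _ => cliqueProb Δ δ k), Finset.sum_const,
          Finset.card_powersetCard, Finset.card_univ, Fintype.card_fin, nsmul_eq_mul]
        intro S hS
        rw [gainMeasure_cliqueEvent hΔ hδ.le, (Finset.mem_powersetCard.1 hS).2]
    _ ≤ _ := by
        rw [mul_pow]
        refine mul_le_mul_of_nonneg_right ?_ (cliqueProb_pos hδ k).le
        exact_mod_cast Nat.choose_le_pow n k

/-- The **second moment method**: a bound for the probability that no event of a finite family
occurs. -/
lemma sq_sum_mul_measureReal_iInter_compl_le {Ω κ : Type*} [MeasurableSpace Ω] (P : Measure Ω)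
    [IsProbabilityMeasure P] (F : Finset κ) {B : κ → Set Ω} (hB : ∀ s, MeasurableSet (B s)) :
    (∑ s ∈ F, P.real (B s)) ^ 2 * P.real {ω | ∀ s ∈ F, ω ∉ B s}
      ≤ ∑ s ∈ F, ∑ t ∈ F, P.real (B s ∩ B t) - (∑ s ∈ F, P.real (B s)) ^ 2 := by
  set e := ∑ s ∈ F, P.real (B s)
  set N : Ω → ℝ := fun ω => ∑ s ∈ F, (B s).indicator 1 ω with hN
  have hind : ∀ {E : Set Ω}, MeasurableSet E → Integrable (E.indicator (1 : Ω → ℝ)) P :=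
    fun hE => (integrable_const (1 : ℝ)).indicator hE
  have hNint : Integrable N P := integrable_finsetSum _ fun s _ => hind (hB s)
  have hN2 : ∀ ω, N ω ^ 2 = ∑ s ∈ F, ∑ t ∈ F, (B s ∩ B t).indicator 1 ω := fun ω => by
    simp only [hN, sq, Finset.sum_mul_sum, Set.inter_indicator_one, Pi.mul_apply]
  have hN2int : Integrable (fun ω => N ω ^ 2) P := by
    simp only [hN2]
    exact integrable_finsetSum _ fun s _ => integrable_finsetSum _ fun t _ =>
      hind ((hB s).inter (hB t))
  have hEN : ∫ ω, N ω ∂P = e := by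
    simp only [hN]
    rw [integral_finsetSum _ fun s _ => hind (hB s)]
    exact Finset.sum_congr rfl fun s _ => integral_indicator_one (hB s)
  have hEN2 : ∫ ω, N ω ^ 2 ∂P = ∑ s ∈ F, ∑ t ∈ F, P.real (B s ∩ B t) := by
    simp only [hN2]
    rw [integral_finsetSum _ fun s _ => integrable_finsetSum _ fun t _ =>
      hind ((hB s).inter (hB t))]
    refine Finset.sum_congr rfl fun s _ => ?_
    rw [integral_finsetSum _ fun t _ =>
      hind ((hB s).inter (hB t))]
    exact Finset.sum_congr rfl fun t _ => integral_indicator_one ((hB s).inter (hB t))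
  have hZ : MeasurableSet {ω | ∀ s ∈ F, ω ∉ B s} := by
    have : {ω | ∀ s ∈ F, ω ∉ B s} = ⋂ s ∈ F, (B s)ᶜ := by ext; simp
    rw [this]
    exact Finset.measurableSet_biInter F fun s _ => (hB s).compl
  have hsq : ∀ ω, (N ω - e) ^ 2 = N ω ^ 2 - (2 * e) * N ω + e ^ 2 := fun ω => by ring
  have hint : Integrable (fun ω => (N ω - e) ^ 2) P := by
    simp only [hsq]
    exact (hN2int.sub (hNint.const_mul _)).add (integrable_const _)
  calc e ^ 2 * P.real {ω | ∀ s ∈ F, ω ∉ B s}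
      = ∫ ω, {ω | ∀ s ∈ F, ω ∉ B s}.indicator (fun _ => e ^ 2) ω ∂P := by
        rw [integral_indicator_const _ hZ, smul_eq_mul, mul_comm]
    -- Chebyshev's argument: where no event occurs, `N = 0` and the squared deviation equals `e ^
    -- 2`.
    _ ≤ ∫ ω, (N ω - e) ^ 2 ∂P := by
        refine integral_mono ((integrable_const _).indicator hZ) hint fun ω => ?_
        by_cases h : ω ∈ {ω | ∀ s ∈ F, ω ∉ B s}
        · rw [Set.indicator_of_mem h]
          have : N ω = 0 := Finset.sum_eq_zero fun s hs => Set.indicator_of_notMem (h s hs) _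
          simp [this]
        · rw [Set.indicator_of_notMem h]
          positivity
    _ = _ := by
        simp only [hsq]
        rw [integral_add (f := fun ω => N ω ^ 2 - 2 * e * N ω) (hN2int.sub (hNint.const_mul _))
          (integrable_const _), integral_sub hN2int (hNint.const_mul _), integral_const_mul, hEN, hEN2, integral_const]
        simp
        ring

lemma card_filter_subset_powersetCard_le {ι : Type*} [Fintype ι] [DecidableEq ι] (U : Finset ι)
    (k : ℕ) :
    ((Finset.powersetCard k (Finset.univ : Finset ι)).filter (U ⊆ ·)).card
      ≤ (Fintype.card ι - U.card).choose (k - U.card) := by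
  rw [← Finset.card_compl, ← Finset.card_powersetCard]
  refine Finset.card_le_card_of_injOn (· \ U) ?_ ?_
  · intro T hT
    obtain ⟨h1, h2⟩ := Finset.mem_filter.1 hT
    refine Finset.mem_powersetCard.2 ⟨?_, ?_⟩
    · rw [Finset.compl_eq_univ_sdiff]
      exact Finset.sdiff_subset_sdiff (Finset.subset_univ _) le_rfl
    · rw [Finset.card_sdiff_of_subset h2, (Finset.mem_powersetCard.1 h1).2]
  · intro T hT T' hT' h
    have h1 := (Finset.mem_filter.1 hT).2
    have h2 := (Finset.mem_filter.1 hT').2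
    rw [← Finset.sdiff_union_of_subset h1, ← Finset.sdiff_union_of_subset h2]
    simp only at h
    rw [h]

/-- Sort the sets `T` by `U = S ∩ T`, then relax this to `U ⊆ T`, which makes the count a plain
binomial coefficient. -/
lemma sum_card_inter_le {ι : Type*} [Fintype ι] [DecidableEq ι] {k : ℕ} {S : Finset ι}
    (hS : S.card = k) {f : ℕ → ℝ} (hf : ∀ l, 0 ≤ f l) :
    ∑ T ∈ Finset.powersetCard k Finset.univ, f (S ∩ T).card
      ≤ ∑ l ∈ Finset.range (k + 1),
        k.choose l * ((Fintype.card ι - l).choose (k - l) * f l) := by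
  calc ∑ T ∈ Finset.powersetCard k Finset.univ, f (S ∩ T).card
      ≤ ∑ T ∈ Finset.powersetCard k Finset.univ, ∑ U ∈ S.powerset,
          if U ⊆ T then f U.card else 0 := by
        refine Finset.sum_le_sum fun T _ => ?_
        refine le_trans (le_of_eq ?_) (Finset.single_le_sum (fun U _ => ?_)
          (Finset.mem_powerset.2 (Finset.inter_subset_left (s₂ := T))))
        · rw [if_pos Finset.inter_subset_right]
        · split_ifs
          exacts [hf _, le_rfl]
    _ = ∑ U ∈ S.powerset, ((Finset.powersetCard k Finset.univ).filter (U ⊆ ·)).card * f U.card := by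
        rw [Finset.sum_comm]
        refine Finset.sum_congr rfl fun U _ => ?_
        rw [← Finset.sum_filter, Finset.sum_const, nsmul_eq_mul]
    _ ≤ ∑ U ∈ S.powerset, (Fintype.card ι - U.card).choose (k - U.card) * f U.card := by
        refine Finset.sum_le_sum fun U _ => mul_le_mul_of_nonneg_right ?_ (hf _)
        exact_mod_cast card_filter_subset_powersetCard_le U k
    _ = _ := by
        rw [Finset.sum_powerset_apply_card
          (fun l => ((Fintype.card ι - l).choose (k - l) : ℝ) * f l), hS]
        simp only [nsmul_eq_mul]

/-- Factor by factor, this is `(k - j) / (n - j) ≤ k / n`. -/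
lemma descFactorial_mul_pow_le {k n : ℕ} (hkn : k ≤ n) (l : ℕ) :
    k.descFactorial l * n ^ l ≤ n.descFactorial l * k ^ l := by
  induction l with
  | zero => simp
  | succ l ih =>
    have h : (k - l) * n ≤ (n - l) * k := by
      rw [Nat.sub_mul, Nat.sub_mul, mul_comm k n]
      exact Nat.sub_le_sub_left (Nat.mul_le_mul_left l hkn) _
    calc k.descFactorial (l + 1) * n ^ (l + 1)
        = ((k - l) * n) * (k.descFactorial l * n ^ l) := by
          rw [Nat.descFactorial_succ]; ring
      _ ≤ ((n - l) * k) * (n.descFactorial l * k ^ l) := Nat.mul_le_mul h ih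
      _ = _ := by rw [Nat.descFactorial_succ]; ring

lemma choose_sub_mul_pow_le {k n l : ℕ} (hlk : l ≤ k) (hkn : k ≤ n) :
    (n - l).choose (k - l) * n ^ l ≤ n.choose k * k ^ l := by
  have h1 := Nat.choose_mul (n := n) (k := k) (s := l) hlk
  have h2 := descFactorial_mul_pow_le hkn l
  rw [Nat.descFactorial_eq_factorial_mul_choose, Nat.descFactorial_eq_factorial_mul_choose,
    mul_assoc, mul_assoc] at h2
  have h3 := Nat.le_of_mul_le_mul_left h2 (Nat.factorial_pos l)
  refine Nat.le_of_mul_le_mul_left ?_ (Nat.choose_pos (hlk.trans hkn))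
  calc n.choose l * ((n - l).choose (k - l) * n ^ l)
      = n.choose k * (k.choose l * n ^ l) := by rw [← mul_assoc, ← h1, mul_assoc]
    _ ≤ n.choose k * (n.choose l * k ^ l) := Nat.mul_le_mul_left _ h3
    _ = _ := by ring

/-- The second moment bound: a clique of `k` surviving links exists with high probability as soon
as `k ^ 2 / n * exp Δ * (1 - exp (-δ)) ^ (1 - k)` is small. -/
lemma gainMeasure_forall_not_clique_le {n : ℕ} {Δ δ : ℝ} (hΔ : 0 ≤ Δ) (hδ : 0 < δ) {k : ℕ}
    (hk : 0 < k) (hkn : k ≤ n) {β : ℝ} (hβ2 : β ≤ 1 / 2)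
    (hβ : (k : ℝ) ^ 2 / n * (Real.exp (-Δ) * (1 - Real.exp (-δ)) ^ (k - 1))⁻¹ ≤ β) :
    (gainMeasure n).real {x | ∀ S : Finset (Fin n), S.card = k → x ∉ cliqueEvent Δ δ S}
      ≤ 2 * β := by
  have hn : (0 : ℝ) < n := by exact_mod_cast hk.trans_le hkn
  have ha := one_sub_exp_neg_pos hδ
  have ha1 := one_sub_exp_neg_lt_one δ
  have hβ0 : 0 ≤ β := le_trans (by positivity) hβ
  have hM : (0 : ℝ) < n.choose k := by exact_mod_cast Nat.choose_pos hkn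
  have hπ := cliqueProb_pos (Δ := Δ) hδ k
  have hterm : ∀ l ∈ Finset.range (k + 1),
      (k.choose l : ℝ) * ((n - l).choose (k - l) * (cliqueProb Δ δ l)⁻¹)
        ≤ n.choose k * β ^ l := by
    intro l hl
    have hlk : l ≤ k := Nat.lt_succ_iff.1 (Finset.mem_range.1 hl)
    have h1 : ((n - l).choose (k - l) : ℝ) ≤ n.choose k * (k / n : ℝ) ^ l := by
      rw [div_pow, ← mul_div_assoc, le_div_iff₀ (by positivity)]
      exact_mod_cast choose_sub_mul_pow_le hlk hkn
    have h2 : (k.choose l : ℝ) ≤ (k : ℝ) ^ l := by exact_mod_cast Nat.choose_le_pow k l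
    calc (k.choose l : ℝ) * ((n - l).choose (k - l) * (cliqueProb Δ δ l)⁻¹)
        ≤ (k : ℝ) ^ l * (n.choose k * (k / n : ℝ) ^ l * (cliqueProb Δ δ l)⁻¹) := by
          have := (cliqueProb_pos (Δ := Δ) hδ l).le
          gcongr
      _ = n.choose k * ((k : ℝ) ^ 2 / n *
            (Real.exp (-Δ) * (1 - Real.exp (-δ)) ^ (l - 1))⁻¹) ^ l := by
          rw [cliqueProb, ← inv_pow, mul_pow _ _ l, div_pow, div_pow]
          ring
      _ ≤ n.choose k * β ^ l := by
          -- Raising the exponent from `l - 1` to `k - 1` shrinks a power of a number in `(0, 1)`,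
          -- hence enlarges its inverse.
          gcongr
          refine le_trans ?_ hβ
          gcongr ?_ * ?_⁻¹
          gcongr ?_ * ?_
          exact pow_le_pow_of_le_one ha.le ha1.le (by omega)
  -- The sum is at most `1 / (1 - β)`, and `β ≤ 1 / 2`.
  have hgeom : ∑ l ∈ Finset.range (k + 1), β ^ l ≤ 1 + 2 * β := by
    have h := geom_sum_mul_neg β (k + 1)
    have hb : 0 ≤ β ^ (k + 1) := by positivity
    have hs : 0 ≤ ∑ l ∈ Finset.range (k + 1), β ^ l := by positivity
    nlinarith
  have h2m := sq_sum_mul_measureReal_iInter_compl_le (gainMeasure n)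
    (Finset.powersetCard k Finset.univ) (measurableSet_cliqueEvent Δ δ)
  have he : ∑ S ∈ Finset.powersetCard k Finset.univ, (gainMeasure n).real (cliqueEvent Δ δ S)
      = n.choose k * cliqueProb Δ δ k := by
    rw [Finset.sum_congr rfl (g := fun _ => cliqueProb Δ δ k), Finset.sum_const,
      Finset.card_powersetCard, Finset.card_univ, Fintype.card_fin, nsmul_eq_mul]
    intro S hS
    rw [gainMeasure_cliqueEvent hΔ hδ.le, (Finset.mem_powersetCard.1 hS).2]
  have he2 : ∑ S ∈ Finset.powersetCard k Finset.univ, ∑ T ∈ Finset.powersetCard k Finset.univ,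
      (gainMeasure n).real (cliqueEvent Δ δ S ∩ cliqueEvent Δ δ T)
      ≤ (n.choose k * cliqueProb Δ δ k) ^ 2 * (1 + 2 * β) := by
    calc _ ≤ ∑ S ∈ Finset.powersetCard k (Finset.univ : Finset (Fin n)),
          cliqueProb Δ δ k ^ 2 * (n.choose k * (1 + 2 * β)) := by
          refine Finset.sum_le_sum fun S hS => ?_
          have hSk := (Finset.mem_powersetCard.1 hS).2
          calc _ = ∑ T ∈ Finset.powersetCard k (Finset.univ : Finset (Fin n)),
                cliqueProb Δ δ k ^ 2 * (cliqueProb Δ δ (S ∩ T).card)⁻¹ := by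
                refine Finset.sum_congr rfl fun T hT => ?_
                rw [gainMeasure_cliqueEvent_inter hΔ hδ, hSk, (Finset.mem_powersetCard.1 hT).2, sq]
            _ ≤ _ := by
                rw [← Finset.mul_sum]
                refine mul_le_mul_of_nonneg_left ?_ (by positivity)
                refine (sum_card_inter_le hSk (f := fun l => (cliqueProb Δ δ l)⁻¹)
                  fun l => (inv_pos.2 (cliqueProb_pos hδ l)).le).trans ?_
                rw [Fintype.card_fin]
                refine (Finset.sum_le_sum hterm).trans ?_
                rw [← Finset.mul_sum]
                gcongr
      _ = _ := by
          rw [Finset.sum_const, Finset.card_powersetCard, Finset.card_univ, Fintype.card_fin,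
            nsmul_eq_mul]
          ring
  rw [he] at h2m
  have hset : {x | ∀ S : Finset (Fin n), S.card = k → x ∉ cliqueEvent Δ δ S}
      = {x | ∀ S ∈ Finset.powersetCard k Finset.univ, x ∉ cliqueEvent Δ δ S} := by
    ext x; simp [Finset.mem_powersetCard]
  rw [hset]
  have hpos : (0 : ℝ) < (n.choose k * cliqueProb Δ δ k) ^ 2 := by positivity
  refine le_of_mul_le_mul_left ?_ hpos
  linarith

/-! ### Stability of the rate and growth of logarithms -/

lemma log_one_add_sub_le {x y : ℝ} (hx : 0 ≤ x) (hy : 0 ≤ y) :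
    Real.log (1 + x) - Real.log (1 + y) ≤ |x - y| := by
  rw [← Real.log_div (by positivity) (by positivity)]
  refine (Real.log_le_sub_one_of_pos (by positivity)).trans ?_
  have : (1 + x) / (1 + y) - 1 = (x - y) / (1 + y) := by field_simp; ring
  rw [this]
  refine (div_le_div_of_nonneg_right (le_abs_self _) (by positivity)).trans ?_
  exact div_le_self (abs_nonneg _) (by linarith)

lemma abs_log_one_add_sub_le {x y : ℝ} (hx : 0 ≤ x) (hy : 0 ≤ y) :
    |Real.log (1 + x) - Real.log (1 + y)| ≤ |x - y| := by
  refine abs_le'.2 ⟨log_one_add_sub_le hx hy, ?_⟩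
  rw [neg_sub, abs_sub_comm]
  exact log_one_add_sub_le hy hx

/-- If numerator and denominator are close to `p * l` and `κ * l`, the logarithmic rate is close to
that of the ratio `p / κ`. -/
lemma abs_log_one_add_div_sub_le {u D p κ l r K : ℝ} (hu : 0 ≤ u) (hp : 0 ≤ p) (hκ : 0 < κ)
    (hl : 0 < l) (h1 : |u - p * l| ≤ l * r) (h2 : |D - κ * l| ≤ K * (l * r))
    (h3 : K * r ≤ κ / 2) :
    |Real.log (1 + u / D) - Real.log (1 + p / κ)| ≤ 2 * (1 + p / κ * K) / κ * r := by
  have hD : κ * l / 2 ≤ D := by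
    have := (abs_le.1 h2).1
    nlinarith
  have hD0 : 0 < D := lt_of_lt_of_le (by positivity) hD
  refine (abs_log_one_add_sub_le (by positivity) (by positivity)).trans ?_
  have h4 : u / D - p / κ = ((u - p * l) - p / κ * (D - κ * l)) / D := by
    field_simp; ring
  have h5 : |(u - p * l) - p / κ * (D - κ * l)| ≤ l * r + p / κ * (K * (l * r)) := by
    refine (abs_sub _ _).trans (add_le_add h1 ?_)
    rw [abs_mul, abs_of_nonneg (by positivity : 0 ≤ p / κ)]
    exact mul_le_mul_of_nonneg_left h2 (by positivity)
  rw [h4, abs_div, abs_of_pos hD0]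
  calc |(u - p * l) - p / κ * (D - κ * l)| / D
      ≤ (l * r + p / κ * (K * (l * r))) / (κ * l / 2) :=
        div_le_div₀ ((abs_nonneg _).trans h5) h5 (by positivity) hD
    _ = _ := by field_simp

lemma tendsto_log_div_self : Tendsto (fun l : ℝ => Real.log l / l) atTop (𝓝 0) :=
  Real.isLittleO_log_id_atTop.tendsto_div_nhds_zero

lemma tendsto_sqrt_log_div_self :
    Tendsto (fun l : ℝ => Real.sqrt (Real.log l / l)) atTop (𝓝 0) := by
  have := (Real.continuous_sqrt.tendsto 0).comp tendsto_log_div_self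
  rwa [Real.sqrt_zero] at this

lemma eventually_mul_log_le (C : ℝ) : ∀ᶠ l : ℝ in atTop, C * Real.log l ≤ l := by
  have h : Tendsto (fun l : ℝ => C * (Real.log l / l)) atTop (𝓝 (C * 0)) :=
    tendsto_log_div_self.const_mul C
  rw [mul_zero] at h
  filter_upwards [h.eventually_le_const one_pos, eventually_gt_atTop 0] with l hl hl0
  rwa [← mul_div_assoc, div_le_one hl0] at hl

/-- The right side is `√(l * log l)`. It absorbs the errors of order `log l` in the clique size and
the direct gains, and the constant noise. -/
lemma eventually_mul_log_add_le {C : ℝ} (hC : 0 ≤ C) :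
    ∀ᶠ l : ℝ in atTop, C * (Real.log l + 1) ≤ l * Real.sqrt (Real.log l / l) := by
  filter_upwards [eventually_mul_log_le (4 * C ^ 2), eventually_gt_atTop 0,
    Real.tendsto_log_atTop.eventually_ge_atTop 1] with l h1 h2 h3
  have h4 : (l * Real.sqrt (Real.log l / l)) ^ 2 = l * Real.log l := by
    rw [mul_pow, Real.sq_sqrt (by positivity)]
    field_simp
  refine (pow_le_pow_iff_left₀ (by positivity) (by positivity) two_ne_zero).1 ?_
  rw [h4]
  calc (C * (Real.log l + 1)) ^ 2 ≤ (C * (Real.log l + Real.log l)) ^ 2 := by gcongr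
    _ = 4 * C ^ 2 * Real.log l * Real.log l := by ring
    _ ≤ l * Real.log l := by gcongr

/-! ### The number of active links -/

lemma card_active_lt {n : ℕ} (S : SelectionRule n) {Δ δ : ℝ} {k : ℕ} {x : Fin n × Fin n → ℝ}
    (hx : ¬ ∃ S : Finset (Fin n), S.card = k ∧ x ∈ cliqueEvent Δ δ S) :
    (active S Δ δ fun j i => x (j, i)).card < k := by
  by_contra! h
  obtain ⟨B, hB, hBk⟩ := Finset.exists_subset_card_eq h
  obtain ⟨h1, h2⟩ := (S.isLargest (phaseOne Δ fun j i => x (j, i))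
    (compatGraph δ fun j i => x (j, i))).1
  exact hx ⟨B, hBk, mem_cliqueEvent_iff.2 ⟨hB.trans h1, h2.subset (Finset.coe_subset.2 hB)⟩⟩

lemma le_card_active {n : ℕ} (S : SelectionRule n) {Δ δ : ℝ} {k : ℕ} {x : Fin n × Fin n → ℝ}
    (hx : ¬ ∀ S : Finset (Fin n), S.card = k → x ∉ cliqueEvent Δ δ S) :
    k ≤ (active S Δ δ fun j i => x (j, i)).card := by
  push Not at hx
  obtain ⟨B, hBk, hB⟩ := hx
  obtain ⟨h1, h2⟩ := mem_cliqueEvent_iff.1 hB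
  rw [← hBk]
  exact (S.isLargest _ _).2 B h1 h2

/-- The size of a largest set of active links, relative to `log n`. -/
noncomputable def sizeConst (α' δ : ℝ) : ℝ :=
  α' / -Real.log (1 - Real.exp (-δ))

lemma neg_log_one_sub_exp_pos {δ : ℝ} (hδ : 0 < δ) : 0 < -Real.log (1 - Real.exp (-δ)) :=
  neg_pos.2 (Real.log_neg (one_sub_exp_neg_pos hδ) (one_sub_exp_neg_lt_one δ))

lemma sizeConst_pos {α' δ : ℝ} (hα : 0 < α') (hδ : 0 < δ) : 0 < sizeConst α' δ :=
  div_pos hα (neg_log_one_sub_exp_pos hδ)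

lemma rBar_eq {α' δ : ℝ} (hα : 0 < α') (hδ : 0 < δ) :
    rBar α' δ = Real.log (1 + (1 - α') / (sizeConst α' δ * truncMean δ)) := by
  have h1 := neg_log_one_sub_exp_pos hδ
  have h2 := truncMean_pos hδ
  rw [rBar, sizeConst]
  congr 1
  generalize Real.log (1 - Real.exp (-δ)) = z at *
  have : z ≠ 0 := by linarith
  field_simp
  ring

lemma exp_neg_mul_log {l : ℝ} (hl : 0 < l) (k : ℕ) :
    Real.exp (-(k * Real.log l)) = (l ^ k)⁻¹ := by
  rw [Real.exp_neg, ← Real.log_pow, Real.exp_log (by positivity)]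

lemma pow_eq_exp_neg {δ : ℝ} (hδ : 0 < δ) (k : ℕ) :
    (1 - Real.exp (-δ)) ^ k = Real.exp (-(k * -Real.log (1 - Real.exp (-δ)))) := by
  rw [mul_neg, neg_neg, ← Real.log_pow, Real.exp_log (pow_pos (one_sub_exp_neg_pos hδ) k)]

/-- With high probability at most `(α' * log n + 2 * log (log n)) / (-log (1 - exp (-δ))) + 1` links
are active. -/
lemma gainMeasure_exists_large_clique_le {n : ℕ} {α' δ l : ℝ} (hα1 : α' ≤ 1) (hδ : 0 < δ)
    (hl : 1 ≤ l) (hn : (n : ℝ) = Real.exp l) :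
    (gainMeasure n).real {x | ∃ S : Finset (Fin n),
        S.card = ⌈(α' * l + 2 * Real.log l) / -Real.log (1 - Real.exp (-δ))⌉₊ + 1 ∧
        x ∈ cliqueEvent ((1 - α') * l) δ S} ≤ l⁻¹ := by
  have hb := neg_log_one_sub_exp_pos hδ
  have hl0 : 0 < l := by linarith
  have ha := one_sub_exp_neg_pos hδ
  refine (gainMeasure_exists_clique_le (mul_nonneg (by linarith) hl0.le) hδ _).trans ?_
  -- The `+ 1` in the cardinality makes the exponent `k`, the ceiling itself.
  rw [Nat.add_sub_cancel]
  set k := ⌈(α' * l + 2 * Real.log l) / -Real.log (1 - Real.exp (-δ))⌉₊ with hk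
  have h1 : α' * l + 2 * Real.log l ≤ k * -Real.log (1 - Real.exp (-δ)) := by
    rw [← div_le_iff₀ hb]
    exact Nat.le_ceil _
  have h2 : n * (Real.exp (-((1 - α') * l)) * (1 - Real.exp (-δ)) ^ k) ≤ (l ^ 2)⁻¹ := by
    rw [hn, pow_eq_exp_neg hδ, ← Real.exp_add, ← Real.exp_add, ← exp_neg_mul_log hl0]
    refine Real.exp_le_exp.2 ?_
    push_cast
    linarith
  have h3 : (l ^ 2)⁻¹ ≤ l⁻¹ := inv_anti₀ hl0 (by nlinarith)
  have h4 : l⁻¹ ≤ 1 := inv_le_one_of_one_le₀ hl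
  -- The base is already at most `l⁻²`, so the outer power can be discarded.
  refine (pow_le_of_le_one (by positivity) (h2.trans (h3.trans h4)) (by omega)).trans ?_
  exact h2.trans h3

/-- With high probability at least `⌊(α' * log n - 4 * log (log n)) / (-log (1 - exp (-δ)))⌋` links
are active. -/
lemma gainMeasure_forall_not_medium_clique_le {n : ℕ} {α' δ l : ℝ} (hα1 : α' ≤ 1)
    (hδ : 0 < δ) (hl : 1 ≤ l) (hn : (n : ℝ) = Real.exp l)
    (h1 : 1 ≤ (α' * l - 4 * Real.log l) / -Real.log (1 - Real.exp (-δ)))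
    (h2 : sizeConst α' δ * l ≤ Real.exp l) (h3 : sizeConst α' δ ^ 2 * l⁻¹ ≤ 1 / 2) :
    (gainMeasure n).real {x | ∀ S : Finset (Fin n),
        S.card = ⌊(α' * l - 4 * Real.log l) / -Real.log (1 - Real.exp (-δ))⌋₊ →
        x ∉ cliqueEvent ((1 - α') * l) δ S} ≤ 2 * (sizeConst α' δ ^ 2 * l⁻¹) := by
  have hb := neg_log_one_sub_exp_pos hδ
  have hl0 : 0 < l := by linarith
  have ha := one_sub_exp_neg_pos hδ
  have hlog := Real.log_nonneg hl
  set k := ⌊(α' * l - 4 * Real.log l) / -Real.log (1 - Real.exp (-δ))⌋₊ with hk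
  have hk1 : (k : ℝ) ≤ (α' * l - 4 * Real.log l) / -Real.log (1 - Real.exp (-δ)) :=
    Nat.floor_le (by linarith)
  have hk2 : (k : ℝ) ≤ sizeConst α' δ * l := by
    refine hk1.trans ?_
    rw [sizeConst, div_mul_eq_mul_div]
    gcongr
    linarith
  have hk3 : k * -Real.log (1 - Real.exp (-δ)) ≤ α' * l - 4 * Real.log l := by
    rwa [le_div_iff₀ hb] at hk1
  have hkpos : 0 < k := Nat.floor_pos.2 h1
  refine gainMeasure_forall_not_clique_le (mul_nonneg (by linarith) hl0.le) hδ hkpos ?_ h3 ?_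
  · have : (k : ℝ) ≤ n := by rw [hn]; exact hk2.trans h2
    exact_mod_cast this
  -- The `4 * log l` subtracted in the size yields `l⁻⁴`, enough to beat the factor `k ^ 2 = O(l ^
  -- 2)`.
  · have h4 : (n : ℝ)⁻¹ * (Real.exp (-((1 - α') * l)) * (1 - Real.exp (-δ)) ^ (k - 1))⁻¹
        ≤ (l ^ 4)⁻¹ := by
      rw [hn, pow_eq_exp_neg hδ, ← Real.exp_add, ← Real.exp_neg, ← Real.exp_neg, ← Real.exp_add,
        ← exp_neg_mul_log hl0, Nat.cast_pred hkpos]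
      refine Real.exp_le_exp.2 ?_
      push_cast
      linarith
    calc (k : ℝ) ^ 2 / n * (Real.exp (-((1 - α') * l)) * (1 - Real.exp (-δ)) ^ (k - 1))⁻¹
        = (k : ℝ) ^ 2 *
          ((n : ℝ)⁻¹ * (Real.exp (-((1 - α') * l)) * (1 - Real.exp (-δ)) ^ (k - 1))⁻¹) := by ring
      _ ≤ (sizeConst α' δ * l) ^ 2 * (l ^ 4)⁻¹ := by gcongr
      _ = sizeConst α' δ ^ 2 * (l ^ 2)⁻¹ := by field_simp
      _ ≤ sizeConst α' δ ^ 2 * l⁻¹ := by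
        gcongr
        nlinarith

/-! ### From typical gains to rates -/

/-- Deterministic rate bound: if the number of active links, the direct gains and the interference
are close to their typical values, then the rates are close to `rBar`. -/
lemma abs_rate_sub_rBar_le {n : ℕ} {α' δ ρ l r e : ℝ} (hα : 0 < α') (hα1 : α' ≤ 1) (hδ : 0 < δ)
    (hl : 0 < l) {G : Fin n → Fin n → ℝ} {A : Finset (Fin n)} {i : Fin n}
    (hi : i ∈ A) (hcard : |(A.card : ℝ) - 1 - sizeConst α' δ * l| ≤ l * r)
    (hgain : |G i i - (1 - α') * l| ≤ l * r) (hgain0 : 0 ≤ G i i)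
    (hsum : |∑ j ∈ A.erase i, (G j i - truncMean δ)| ≤ e * (l * r))
    (hρ : |1 / ρ| ≤ l * r)
    (hr : (1 + e + truncMean δ) * r ≤ sizeConst α' δ * truncMean δ / 2) :
    |rate ρ G A i - rBar α' δ| ≤
      2 * (1 + (1 - α') / (sizeConst α' δ * truncMean δ) * (1 + e + truncMean δ))
        / (sizeConst α' δ * truncMean δ) * r := by
  have hμ := truncMean_pos hδ
  have hL := sizeConst_pos hα hδ
  rw [rBar_eq hα hδ, rate, sinr]
  refine abs_log_one_add_div_sub_le hgain0 (by linarith) (mul_pos hL hμ) hl hgain ?_ hr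
  have h1 : ∑ j ∈ A.erase i, G j i = ∑ j ∈ A.erase i, (G j i - truncMean δ)
      + (A.card - 1) * truncMean δ := by
    rw [Finset.sum_sub_distrib, Finset.sum_const, Finset.card_erase_of_mem hi, nsmul_eq_mul,
      Nat.cast_pred (Finset.card_pos.2 ⟨i, hi⟩)]
    ring
  have h2 : 1 / ρ + ∑ j ∈ A.erase i, G j i - sizeConst α' δ * truncMean δ * l
      = 1 / ρ + ∑ j ∈ A.erase i, (G j i - truncMean δ)
        + truncMean δ * ((A.card : ℝ) - 1 - sizeConst α' δ * l) := by
    rw [h1]; ring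
  rw [h2]
  have h3 : |truncMean δ * ((A.card : ℝ) - 1 - sizeConst α' δ * l)| ≤ truncMean δ * (l * r) := by
    rw [abs_mul, abs_of_pos hμ]
    gcongr
  have h4 := abs_add_three (1 / ρ) (∑ j ∈ A.erase i, (G j i - truncMean δ))
    (truncMean δ * ((A.card : ℝ) - 1 - sizeConst α' δ * l))
  linarith

lemma tendsto_log_natCast : Tendsto (fun n : ℕ => Real.log n) atTop atTop :=
  Real.tendsto_log_atTop.comp tendsto_natCast_atTop_atTop

/-- The relative size of the fluctuations when `l = log n`. -/
noncomputable def relErr (l : ℝ) : ℝ :=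
  Real.sqrt (Real.log l / l)

/-- The factor by which the interference may deviate from its mean, relative to `l * relErr l`. -/
noncomputable def devConst (α' δ : ℝ) : ℝ :=
  Real.sqrt (sizeConst α' δ + 1) * δ

lemma devConst_pos {α' δ : ℝ} (hα : 0 < α') (hδ : 0 < δ) : 0 < devConst α' δ := by
  have := sizeConst_pos hα hδ
  unfold devConst
  positivity

/-- The scale `l = log n` is large enough for the asymptotic estimates to apply. -/
structure IsLargeScale (α' δ ρ l : ℝ) : Prop where
  one_le : 1 ≤ l
  one_le_log : 1 ≤ Real.log l
  log_le : (4 / -Real.log (1 - Real.exp (-δ)) + 2) * (Real.log l + 1) ≤ l * relErr l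
  noise_le : |1 / ρ| * (Real.log l + 1) ≤ l * relErr l
  relErr_le : (1 + devConst α' δ + truncMean δ) * relErr l ≤ sizeConst α' δ * truncMean δ / 2
  relErr_le_one : relErr l ≤ 1
  one_le_size : 1 ≤ (α' * l - 4 * Real.log l) / -Real.log (1 - Real.exp (-δ))
  size_le : sizeConst α' δ * l ≤ Real.exp l
  prob_le : sizeConst α' δ ^ 2 * l⁻¹ ≤ 1 / 2

lemma eventually_isLargeScale {α' δ : ℝ} (hα : 0 < α') (hδ : 0 < δ) (ρ : ℝ) :
    ∀ᶠ l : ℝ in atTop, IsLargeScale α' δ ρ l := by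
  have hμ := truncMean_pos hδ
  have hL := sizeConst_pos hα hδ
  have hb := neg_log_one_sub_exp_pos hδ
  have hκ : 0 < sizeConst α' δ * truncMean δ / 2 := by positivity
  have t1 : Tendsto (fun l : ℝ => (1 + devConst α' δ + truncMean δ) *
      Real.sqrt (Real.log l / l)) atTop (𝓝 0) := by
    simpa using tendsto_sqrt_log_div_self.const_mul (1 + devConst α' δ + truncMean δ)
  have t2 : Tendsto (fun l : ℝ => sizeConst α' δ ^ 2 * l⁻¹) atTop (𝓝 0) := by
    simpa using tendsto_inv_atTop_zero.const_mul (sizeConst α' δ ^ 2)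
  have t3 : Tendsto (fun l : ℝ => sizeConst α' δ * l / Real.exp l) atTop (𝓝 0) := by
    have := (Real.tendsto_pow_mul_exp_neg_atTop_nhds_zero 1).const_mul (sizeConst α' δ)
    rw [mul_zero] at this
    refine this.congr fun l => ?_
    rw [Real.exp_neg, pow_one]
    ring
  filter_upwards [eventually_ge_atTop 1, Real.tendsto_log_atTop.eventually_ge_atTop 1,
    eventually_mul_log_add_le (C := 4 / -Real.log (1 - Real.exp (-δ)) + 2) (by positivity),
    eventually_mul_log_add_le (abs_nonneg (1 / ρ)), t1.eventually_le_const hκ,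
    tendsto_sqrt_log_div_self.eventually_le_const one_pos,
    eventually_mul_log_le (α'⁻¹ * (4 + -Real.log (1 - Real.exp (-δ)))),
    t3.eventually_le_const one_pos,
    t2.eventually_le_const (by norm_num : (0 : ℝ) < 1 / 2)] with l h1 h2 h3 h4 h5 h6 h7 h8 h9
  refine ⟨h1, h2, h3, h4, h5, h6, ?_, ?_, h9⟩
  · rw [le_div_iff₀ hb]
    -- This gives `α' * l - 4 * log l ≥ b * log l ≥ b` with `b = -log (1 - exp (-δ))`.
    rw [mul_assoc, inv_mul_le_iff₀ hα] at h7
    have := mul_le_mul_of_nonneg_left h2 hb.le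
    linarith
  · rwa [div_le_one (Real.exp_pos l)] at h8

namespace IsLargeScale

variable {α' δ ρ l : ℝ}

lemma pos (h : IsLargeScale α' δ ρ l) : 0 < l :=
  one_pos.trans_le h.one_le

lemma relErr_pos (h : IsLargeScale α' δ ρ l) : 0 < relErr l :=
  Real.sqrt_pos.2 (div_pos (one_pos.trans_le h.one_le_log) h.pos)

lemma two_mul_log_le (h : IsLargeScale α' δ ρ l) (hδ : 0 < δ) :
    4 / -Real.log (1 - Real.exp (-δ)) * Real.log l + 2 * Real.log l + 2 ≤ l * relErr l := by
  refine le_trans ?_ h.log_le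
  have : 0 ≤ 4 / -Real.log (1 - Real.exp (-δ)) := by
    have := neg_log_one_sub_exp_pos hδ
    positivity
  linarith

lemma abs_noise_le (h : IsLargeScale α' δ ρ l) : |1 / ρ| ≤ l * relErr l := by
  refine le_trans (le_mul_of_one_le_right (abs_nonneg _) ?_) h.noise_le
  linarith [h.one_le_log]

lemma card_sub_le (h : IsLargeScale α' δ ρ l) (hα : 0 < α') (hδ : 0 < δ) {m : ℕ}
    (hlow : ⌊(α' * l - 4 * Real.log l) / -Real.log (1 - Real.exp (-δ))⌋₊ ≤ m)
    (hup : m < ⌈(α' * l + 2 * Real.log l) / -Real.log (1 - Real.exp (-δ))⌉₊ + 1) :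
    |(m : ℝ) - 1 - sizeConst α' δ * l| ≤ l * relErr l ∧ (m : ℝ) ≤ (sizeConst α' δ + 1) * l := by
  have hb := neg_log_one_sub_exp_pos hδ
  have hl := h.pos
  have hlog : 0 < Real.log l := one_pos.trans_le h.one_le_log
  have h3 := h.two_mul_log_le hδ
  have h4 : l * relErr l ≤ l := mul_le_of_le_one_right hl.le h.relErr_le_one
  have h5 : 2 / -Real.log (1 - Real.exp (-δ)) * Real.log l
      ≤ 4 / -Real.log (1 - Real.exp (-δ)) * Real.log l := by
    gcongr
    norm_num
  have hup' : (m : ℝ) ≤ sizeConst α' δ * l + 2 / -Real.log (1 - Real.exp (-δ)) * Real.log l + 1 := by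
    have h6 : (m : ℝ) ≤ ⌈(α' * l + 2 * Real.log l) / -Real.log (1 - Real.exp (-δ))⌉₊ := by
      exact_mod_cast Nat.lt_succ_iff.1 hup
    refine h6.trans ((Nat.ceil_lt_add_one (by positivity)).le.trans (le_of_eq ?_))
    rw [sizeConst]; ring
  have hlow' : sizeConst α' δ * l - 4 / -Real.log (1 - Real.exp (-δ)) * Real.log l - 1 ≤ m := by
    have h6 : (⌊(α' * l - 4 * Real.log l) / -Real.log (1 - Real.exp (-δ))⌋₊ : ℝ) ≤ m := by
      exact_mod_cast hlow
    have h7 := (Nat.sub_one_lt_floor _).le.trans h6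
    refine le_trans (le_of_eq ?_) h7
    rw [sizeConst]; ring
  refine ⟨abs_le.2 ⟨?_, ?_⟩, ?_⟩ <;> linarith

end IsLargeScale

/-- The constant in the bound for the deviation of the rates from `rBar`. -/
noncomputable def rateConst (α' δ : ℝ) : ℝ :=
  2 * (1 + (1 - α') / (sizeConst α' δ * truncMean δ) * (1 + devConst α' δ + truncMean δ))
    / (sizeConst α' δ * truncMean δ)

lemma rateConst_nonneg {α' δ : ℝ} (hα : 0 < α') (hα1 : α' ≤ 1) (hδ : 0 < δ) :
    0 ≤ rateConst α' δ := by
  have hμ := truncMean_pos hδ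
  have hL := sizeConst_pos hα hδ
  have he := devConst_pos hα hδ
  have : 0 ≤ 1 - α' := by linarith
  unfold rateConst
  positivity

/-- If no exceptional event occurs, all rates are close to `rBar`. -/
lemma IsLargeScale.abs_rate_sub_rBar_lt {α' δ ρ l : ℝ} (h : IsLargeScale α' δ ρ l) (hα : 0 < α')
    (hα1 : α' ≤ 1) (hδ : 0 < δ) {n : ℕ} (S : SelectionRule n) {x : Fin n × Fin n → ℝ}
    (hlarge : ¬ ∃ S : Finset (Fin n),
      S.card = ⌈(α' * l + 2 * Real.log l) / -Real.log (1 - Real.exp (-δ))⌉₊ + 1 ∧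
        x ∈ cliqueEvent ((1 - α') * l) δ S)
    (hmedium : ¬ ∀ S : Finset (Fin n),
      S.card = ⌊(α' * l - 4 * Real.log l) / -Real.log (1 - Real.exp (-δ))⌋₊ →
        x ∉ cliqueEvent ((1 - α') * l) δ S)
    (htyp : ¬ (((active S ((1 - α') * l) δ fun j i => x (j, i)).card : ℝ)
        ≤ (sizeConst α' δ + 1) * l ∧
      ∃ i ∈ active S ((1 - α') * l) δ fun j i => x (j, i),
        (1 - α') * l + 2 * Real.log l < x (i, i) ∨
        devConst α' δ * (l * relErr l) ≤
          |∑ j ∈ (active S ((1 - α') * l) δ fun j i => x (j, i)).erase i,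
            (x (j, i) - truncMean δ)|))
    {i : Fin n} (hi : i ∈ active S ((1 - α') * l) δ fun j i => x (j, i)) :
    |rate ρ (fun j i => x (j, i)) (active S ((1 - α') * l) δ fun j i => x (j, i)) i - rBar α' δ|
      < (rateConst α' δ + 1) * relErr l := by
  have hcard := h.card_sub_le hα hδ (le_card_active S hmedium) (card_active_lt S hlarge)
  have htyp' := not_or.1 fun hor => htyp ⟨hcard.2, i, hi, hor⟩
  have hgt := lt_of_mem_active hi
  have hΔ : 0 ≤ (1 - α') * l := mul_nonneg (by linarith) h.pos.le
  have hb := neg_log_one_sub_exp_pos hδ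
  have hlog := one_pos.trans_le h.one_le_log
  have h2 := h.two_mul_log_le hδ
  have h4 : 0 ≤ 4 / -Real.log (1 - Real.exp (-δ)) * Real.log l := by positivity
  have hlr := mul_pos h.pos h.relErr_pos
  have hle := not_lt.1 htyp'.1
  -- The deterministic bound is not strict; the extra 1 in the constant makes it so.
  refine (abs_rate_sub_rBar_le hα hα1 hδ h.pos hi hcard.1 ?_ (hΔ.trans hgt.le)
    (not_le.1 htyp'.2).le h.abs_noise_le h.relErr_le).trans_lt
    (mul_lt_mul_of_pos_right (lt_add_one (rateConst α' δ)) h.relErr_pos)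
  exact abs_le.2 ⟨by linarith, by linarith⟩

lemma IsLargeScale.gainMeasure_rate_far_le {α' δ ρ l : ℝ} (h : IsLargeScale α' δ ρ l)
    (hα : 0 < α') (hα1 : α' ≤ 1) (hδ : 0 < δ) {n : ℕ} (hn : (n : ℝ) = Real.exp l)
    (S : SelectionRule n) :
    gainMeasure n {x | ¬ ∀ i ∈ active S ((1 - α') * l) δ (fun j i => x (j, i)),
        |rate ρ (fun j i => x (j, i)) (active S ((1 - α') * l) δ (fun j i => x (j, i))) i
          - rBar α' δ| < (rateConst α' δ + 1) * relErr l}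
      ≤ ENNReal.ofReal ((1 + 2 * sizeConst α' δ ^ 2 + (sizeConst α' δ + 1) * 3) * l⁻¹) := by
  have hL := sizeConst_pos hα hδ
  have hl := h.pos
  have hlog := one_pos.trans_le h.one_le_log
  have hbig := gainMeasure_exists_large_clique_le hα1 hδ h.one_le hn
  have hsmall := gainMeasure_forall_not_medium_clique_le hα1 hδ h.one_le hn h.one_le_size h.size_le
    h.prob_le
  have hatyp := gainMeasure_atypical_le S (Δ := (1 - α') * l) (mul_nonneg (by linarith) hl.le) hδ
    (s := 2 * Real.log l) (t := devConst α' δ * (l * relErr l)) (M := (sizeConst α' δ + 1) * l)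
    (by positivity) (mul_pos (devConst_pos hα hδ) (mul_pos hl h.relErr_pos))
  -- `devConst` is chosen so that the Hoeffding exponent is exactly `2 * log l`.
  have hexp : 2 * (devConst α' δ * (l * relErr l)) ^ 2 / ((sizeConst α' δ + 1) * l * δ ^ 2)
      = 2 * Real.log l := by
    rw [devConst, relErr, mul_pow, mul_pow, mul_pow, Real.sq_sqrt (by positivity),
      Real.sq_sqrt (by positivity)]
    field_simp
  have hexp2 : Real.exp (-(2 * Real.log l)) = (l ^ 2)⁻¹ := exp_neg_mul_log hl 2
  rw [hexp, hexp2] at hatyp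
  have htoE : ∀ {B : Set (Fin n × Fin n → ℝ)} {v : ℝ}, (gainMeasure n).real B ≤ v →
      gainMeasure n B ≤ ENNReal.ofReal v := fun h => by
    rw [← ofReal_measureReal]
    exact ENNReal.ofReal_le_ofReal h
  refine (measure_mono (t := _ ∪ _ ∪ _) ?_).trans ((measure_union_le _ _).trans (add_le_add
    ((measure_union_le _ _).trans (add_le_add (htoE hbig) (htoE hsmall))) hatyp)) |>.trans
    (le_of_eq ?_)
  · intro x hx
    by_contra hxB
    exact hx fun i hi => h.abs_rate_sub_rBar_lt hα hα1 hδ S (fun hB => hxB (Or.inl (Or.inl hB)))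
      (fun hB => hxB (Or.inl (Or.inr hB))) (fun hB => hxB (Or.inr hB)) hi
  · rw [← ENNReal.ofReal_add (by positivity) (by positivity),
      ← ENNReal.ofReal_add (by positivity) (by positivity)]
    -- The 3 is one exponential tail and two Hoeffding tails, each `l⁻²`, for at most `(sizeConst α'
    -- δ + 1) * l` links.
    congr 1
    field_simp
    ring

lemma exists_gainMeasure_rate_far_le {α' δ : ℝ} (hα : 0 < α') (hα1 : α' ≤ 1) (hδ : 0 < δ) :
    ∃ c : ℝ, 0 < c ∧ ∃ C : ℝ, ∀ ρ : ℝ, ∀ᶠ n : ℕ in atTop, ∀ S : SelectionRule n,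
      gainMeasure n {x | ¬ ∀ i ∈ active S ((1 - α') * Real.log n) δ (fun j i => x (j, i)),
        |rate ρ (fun j i => x (j, i))
            (active S ((1 - α') * Real.log n) δ (fun j i => x (j, i))) i - rBar α' δ|
          < c * Real.sqrt (Real.log (Real.log n) / Real.log n)}
        ≤ ENNReal.ofReal (C * (Real.log n)⁻¹) := by
  refine ⟨rateConst α' δ + 1, by linarith [rateConst_nonneg hα hα1 hδ],
    1 + 2 * sizeConst α' δ ^ 2 + (sizeConst α' δ + 1) * 3, fun ρ => ?_⟩
  filter_upwards [tendsto_log_natCast.eventually (eventually_isLargeScale hα hδ ρ),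
    eventually_gt_atTop 0] with n hn hn0 S
  exact hn.gainMeasure_rate_far_le hα hα1 hδ (Real.exp_log (by exact_mod_cast hn0)).symm S

/-! ### Asymptotically almost sure events and the conclusion -/

/-- Subadditivity gives `1 ≤ P E + P Eᶜ` even for non-measurable `E`. -/
lemma aas_of_eventually_compl_le {Ω : ℕ → Type*} [∀ n, MeasurableSpace (Ω n)]
    {P : ∀ n, Measure (Ω n)} [∀ n, IsProbabilityMeasure (P n)] {E : ∀ n, Set (Ω n)}
    {u : ℕ → ENNReal} (hu : Tendsto u atTop (𝓝 0)) (h : ∀ᶠ n in atTop, P n (E n)ᶜ ≤ u n) :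
    AAS P E := by
  have h1 : Tendsto (fun n => 1 - u n) atTop (𝓝 1) := by
    simpa using ENNReal.Tendsto.sub (tendsto_const_nhds (x := (1 : ENNReal))) hu
      (Or.inl ENNReal.one_ne_top)
  refine tendsto_of_tendsto_of_tendsto_of_le_of_le' h1 tendsto_const_nhds ?_
    (Eventually.of_forall fun n => prob_le_one)
  filter_upwards [h] with n hn
  rw [tsub_le_iff_right, ← measure_univ (μ := P n), ← Set.union_compl_self (E n)]
  exact (measure_union_le _ _).trans (by gcongr)

lemma AAS.mono {Ω : ℕ → Type*} [∀ n, MeasurableSpace (Ω n)]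
    {P : ∀ n, Measure (Ω n)} [∀ n, IsProbabilityMeasure (P n)] {E F : ∀ n, Set (Ω n)}
    (hE : AAS P E) (h : ∀ᶠ n in atTop, E n ⊆ F n) : AAS P F :=
  tendsto_of_tendsto_of_tendsto_of_le_of_le' hE tendsto_const_nhds
    (h.mono fun _ hn => measure_mono hn) (Eventually.of_forall fun _ => prob_le_one)

end DTBLAS

theorem lemma4 (α' δ : ℝ) (hα : 0 < α') (hα1 : α' ≤ 1) (hδ : 0 < δ) :
    ∃ c : ℝ, 0 < c ∧ ∀ ρ : ℝ, 0 < ρ →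
      ∃ ε : ℕ → ℝ, Tendsto ε atTop (𝓝 0) ∧
        ∀ (S : ∀ n, DTBLAS.SelectionRule n)
          (Ω : ℕ → Type*) [∀ n, MeasurableSpace (Ω n)]
          (P : ∀ n, Measure (Ω n)) [∀ n, IsProbabilityMeasure (P n)]
          (g : ∀ n, Fin n → Fin n → Ω n → ℝ),
          (∀ n, DTBLAS.IsRayleighFading (g n) (P n)) →
          DTBLAS.AAS P (fun n => {ω |
            ∀ i ∈ DTBLAS.active (S n) ((1 - α') * Real.log n) δ (fun j i => g n j i ω),
              |DTBLAS.rate ρ (fun j i => g n j i ω)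
                  (DTBLAS.active (S n) ((1 - α') * Real.log n) δ (fun j i => g n j i ω)) i
                - DTBLAS.rBar α' δ|
              < c * Real.sqrt (Real.log (Real.log n) / Real.log n) * (1 + ε n)}) ∧
          ∀ r : ℝ, r < DTBLAS.rBar α' δ →
            DTBLAS.AAS P (fun n => {ω |
              ∀ i ∈ DTBLAS.active (S n) ((1 - α') * Real.log n) δ (fun j i => g n j i ω),
                r ≤ DTBLAS.rate ρ (fun j i => g n j i ω)
                  (DTBLAS.active (S n) ((1 - α') * Real.log n) δ (fun j i => g n j i ω)) i}) := by
  obtain ⟨c, hc, C, hC⟩ := DTBLAS.exists_gainMeasure_rate_far_le hα hα1 hδ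
  -- The slack in `c` makes the `o(1)` superfluous: it is taken to be zero.
  refine ⟨c, hc, fun ρ _ => ⟨fun _ => 0, tendsto_const_nhds, ?_⟩⟩
  intro S Ω _ P _ g hg
  simp only [add_zero, mul_one]
  have hu : Tendsto (fun n : ℕ => ENNReal.ofReal (C * (Real.log n)⁻¹)) atTop (𝓝 0) := by
    have h := (tendsto_inv_atTop_zero.comp DTBLAS.tendsto_log_natCast).const_mul C
    rw [mul_zero] at h
    simpa using ENNReal.tendsto_ofReal h
  have hclose : DTBLAS.AAS P (fun n => {ω |
      ∀ i ∈ DTBLAS.active (S n) ((1 - α') * Real.log n) δ (fun j i => g n j i ω),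
        |DTBLAS.rate ρ (fun j i => g n j i ω)
            (DTBLAS.active (S n) ((1 - α') * Real.log n) δ (fun j i => g n j i ω)) i
          - DTBLAS.rBar α' δ|
        < c * Real.sqrt (Real.log (Real.log n) / Real.log n)}) := by
    refine DTBLAS.aas_of_eventually_compl_le hu ?_
    filter_upwards [hC ρ] with n hn
    exact ((hg n).measure_le fun G => ¬ ∀ i ∈ DTBLAS.active (S n) ((1 - α') * Real.log n) δ G,
      |DTBLAS.rate ρ G (DTBLAS.active (S n) ((1 - α') * Real.log n) δ G) i - DTBLAS.rBar α' δ|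
        < c * Real.sqrt (Real.log (Real.log n) / Real.log n)).trans (hn (S n))
  refine ⟨hclose, fun r hr => hclose.mono ?_⟩
  have hlim : Tendsto (fun n : ℕ => c * Real.sqrt (Real.log (Real.log n) / Real.log n)) atTop
      (𝓝 0) := by
    simpa using (DTBLAS.tendsto_sqrt_log_div_self.comp DTBLAS.tendsto_log_natCast).const_mul c
  filter_upwards [hlim.eventually_lt_const (sub_pos.2 hr)] with n hn ω hω i hi
  have := (abs_lt.1 (hω i hi)).1
  linarith
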